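/- Let $(X,\mathcal F,\mu)$ be a probability space and let $T:X\to X$ be a measurable map preserving $\mu$. Let $(f_n)_{n\ge 1}$ be a sequence of measurable functions on $X$ with values in $[-\infty,\infty)$ whose positive parts $f_{n,+}=\max\{f_n,0\}$ are all in $L^1(\mu)$. Suppose that there exist a sequence $(\sigma_n)_{n\ge 1}$ of nonnegative integers with $\sigma_1=0$ and $\sigma_n/n\to 0$ as $n\to\infty$, and a sequence $(\rho_n)_{n\ge 1}$ of nonnegative functions in $L^1(\mu)$ with $\rho_n/n\to 0$ $\mu$-almost surely as $n\to\infty$, such that, for all integers $n,m\ge 1$, \[ f_{n+\sigma_n+m}\le f_n+\rho_n+f_m\circ T^{\,n+\sigma_n}\qquad \mu\text{-almost surely.} \] Then there is a measurable function $f:X\to[-\infty,\infty)$ such that $\lim_{n\to\infty} \frac{f_n}{n}=f$ $\mu$-almost surely. -/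

import Mathlib

open Filter Topology MeasureTheory Asymptotics
open scoped ENNReal

/-!
The proof follows the tiling argument for Kingman's theorem, adapted to gaps. Let `L` and `U` be
the lower and upper limits of `f n / n`. As `σ 1 = 0`, the case `n = 1` of the hypothesis reads
`f (m + 1) ≤ g + f m ∘ T` with `g` nonnegative and integrable. Hence `L ≤ L ∘ T`, and since `T`
preserves a finite measure the set `{L < a}` is almost invariant
(`ae_lt_imp_forall_iterate_lt`).

On this set, at almost every point there are infinitely many `j` with `f j < a * j`. As `ρ j / j`
and `σ j / j` tend to zero, some such `j` also has `ρ j ≤ ε * j` and `σ j ≤ ε * j`. So the set of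
points of `{L < a}` at which no such `j` with `j + σ j ≤ k` exists, or `g > k`, becomes negligible
as `k → ∞` (`eventually_notMem_badSet`). Cutting an orbit of length `n` into tiles of length
`j + σ j` at good points and of length one at bad points, the subadditivity hypothesis bounds
`f n` by roughly `(a + O(ε)) * n` plus a Birkhoff sum of `g + |a + ε|` over the visits to the bad
set (`le_sum_of_tiling`). The functions being summed tend to zero in `L¹`, so by the maximal ergodic
inequality their averages are, at almost every point, uniformly at most `ε` for a suitable `k`
(`ae_exists_forall_birkhoffSum_le`); the full pointwise ergodic theorem is not needed. Thus
`U ≤ b` almost everywhere on `{L < a}` for all rational `a < b`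
(`ae_limsup_div_le_of_liminf_div_lt`), which gives `U ≤ L`. The same maximal inequality, applied
to `g`, shows `U < ∞`.
-/

/-! ### The maximal ergodic inequality -/

/-- The maximal function `x ↦ max_{0 ≤ n ≤ k} ∑_{t < n} u (T^t x)`, the empty sum included. It is
defined by the recursion `φ_{k+1} = max 0 (u + φ_k ∘ T)`, which is the form Garsia's argument
uses. -/
noncomputable def maxBirkhoff {X : Type*} (T : X → X) (u : X → ℝ) : ℕ → X → ℝ
  | 0 => fun _ => 0
  | k + 1 => fun x => max 0 (u x + maxBirkhoff T u k (T x))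

section Maximal

variable {X : Type*} {T : X → X} {u : X → ℝ}

lemma maxBirkhoff_nonneg (k : ℕ) (x : X) : 0 ≤ maxBirkhoff T u k x := by
  cases k with
  | zero => exact le_rfl
  | succ k => exact le_max_left _ _

lemma maxBirkhoff_le_succ (k : ℕ) (x : X) :
    maxBirkhoff T u k x ≤ maxBirkhoff T u (k + 1) x := by
  induction k generalizing x with
  | zero => exact maxBirkhoff_nonneg _ _
  | succ k ih => exact max_le_max le_rfl (add_le_add le_rfl (ih (T x)))

lemma monotone_maxBirkhoff (x : X) : Monotone fun k => maxBirkhoff T u k x :=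
  monotone_nat_of_le_succ fun k => maxBirkhoff_le_succ k x

lemma birkhoffSum_le_maxBirkhoff (n : ℕ) (x : X) :
    birkhoffSum T u n x ≤ maxBirkhoff T u n x := by
  induction n generalizing x with
  | zero => simp [maxBirkhoff]
  | succ n ih =>
    rw [birkhoffSum_succ']
    exact (add_le_add le_rfl (ih (T x))).trans (le_max_right _ _)

variable [MeasurableSpace X] {μ : Measure X}

lemma measurable_maxBirkhoff (hT : Measurable T) (hu : Measurable u) (k : ℕ) :
    Measurable (maxBirkhoff T u k) := by
  induction k with
  | zero => exact measurable_const
  | succ k ih => exact measurable_const.max (hu.add (ih.comp hT))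

lemma integrable_maxBirkhoff (hT : MeasurePreserving T μ μ) (hu : Integrable u μ) (k : ℕ) :
    Integrable (maxBirkhoff T u k) μ := by
  induction k with
  | zero => exact integrable_zero _ _ _
  | succ k ih => exact (integrable_zero _ _ _).sup (hu.add (hT.integrable_comp_of_integrable ih))

/-- The maximal ergodic theorem. On `{φ_k > 0}` one has `φ_k ≤ u + φ_k ∘ T`, off it
`φ_k - φ_k ∘ T ≤ 0`, and `φ_k - φ_k ∘ T` has integral zero. -/
lemma setIntegral_maxBirkhoff_pos_nonneg (hT : MeasurePreserving T μ μ) (hum : Measurable u)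
    (hu : Integrable u μ) (k : ℕ) : 0 ≤ ∫ x in {x | 0 < maxBirkhoff T u k x}, u x ∂μ := by
  set φ := maxBirkhoff T u k with hφ
  have hφi : Integrable φ μ := integrable_maxBirkhoff hT hu k
  have hφT : Integrable (fun x => φ (T x)) μ := hT.integrable_comp_of_integrable hφi
  have hs : MeasurableSet {x | 0 < φ x} :=
    measurableSet_lt measurable_const (measurable_maxBirkhoff hT.measurable hum k)
  have hint : ∫ x, φ (T x) ∂μ = ∫ x, φ x ∂μ := by
    have h := integral_map (f := φ) hT.measurable.aemeasurable
      (by rw [hT.map_eq]; exact hφi.aestronglyMeasurable)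
    rw [hT.map_eq] at h
    exact h.symm
  have hpt : ∀ x, φ x - φ (T x) ≤ {x | 0 < φ x}.indicator u x := by
    intro x
    by_cases hx : 0 < φ x
    · rw [Set.indicator_of_mem (by exact hx)]
      cases k with
      | zero => simp [hφ, maxBirkhoff] at hx
      | succ k =>
        have h1 : φ x = max 0 (u x + maxBirkhoff T u k (T x)) := rfl
        have h2 : maxBirkhoff T u k (T x) ≤ φ (T x) := maxBirkhoff_le_succ k (T x)
        rcases max_choice 0 (u x + maxBirkhoff T u k (T x)) with h | h <;> linarith
    · rw [Set.indicator_of_notMem (by exact hx)]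
      have : 0 ≤ φ (T x) := maxBirkhoff_nonneg k (T x)
      linarith
  rw [← integral_indicator hs]
  calc (0 : ℝ) = ∫ x, (φ x - φ (T x)) ∂μ := by rw [integral_sub hφi hφT, hint, sub_self]
    _ ≤ _ := integral_mono (hφi.sub hφT) (hu.indicator hs) hpt

/-- The weak-type maximal inequality for the Birkhoff averages of a nonnegative function. -/
lemma mul_measureReal_lt_birkhoffSum_le [IsProbabilityMeasure μ] (hT : MeasurePreserving T μ μ)
    {h : X → ℝ} (hm : Measurable h) (hi : Integrable h μ) (h0 : ∀ x, 0 ≤ h x) {δ : ℝ} :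
    δ * μ.real {x | ∃ n : ℕ, δ * n < birkhoffSum T h n x} ≤ ∫ x, h x ∂μ := by
  set u : X → ℝ := fun x => h x - δ
  have hum : Measurable u := hm.sub_const δ
  have hui : Integrable u μ := hi.sub (integrable_const δ)
  have hE : ∀ k, δ * μ.real {x | 0 < maxBirkhoff T u k x} ≤ ∫ x, h x ∂μ := by
    intro k
    have h1 := setIntegral_maxBirkhoff_pos_nonneg hT hum hui k
    rw [integral_sub hi.integrableOn (integrable_const δ).integrableOn, setIntegral_const,
      smul_eq_mul] at h1
    have h2 := setIntegral_le_integral (s := {x | 0 < maxBirkhoff T u k x}) hi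
      (Eventually.of_forall h0)
    linarith
  have hmono : Monotone fun k => {x | 0 < maxBirkhoff T u k x} :=
    fun i j hij x hx => lt_of_lt_of_le hx (monotone_maxBirkhoff x hij)
  have hlim : Tendsto (fun k => δ * μ.real {x | 0 < maxBirkhoff T u k x}) atTop
      (𝓝 (δ * μ.real (⋃ k, {x | 0 < maxBirkhoff T u k x}))) :=
    ((ENNReal.tendsto_toReal (measure_ne_top _ _)).comp
      (tendsto_measure_iUnion_atTop hmono)).const_mul δ
  have hsub : {x | ∃ n : ℕ, δ * n < birkhoffSum T h n x} ⊆
      ⋃ k, {x | 0 < maxBirkhoff T u k x} := by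
    rintro x ⟨n, hn⟩
    refine Set.mem_iUnion.2 ⟨n, lt_of_lt_of_le ?_ (birkhoffSum_le_maxBirkhoff n x)⟩
    have : birkhoffSum T u n x = birkhoffSum T h n x - δ * n := by
      simp [birkhoffSum, u, Finset.sum_sub_distrib, mul_comm]
    linarith
  have hle := le_of_tendsto' hlim hE
  rcases le_total 0 δ with hδ | hδ
  · exact (mul_le_mul_of_nonneg_left (measureReal_mono hsub) hδ).trans hle
  · exact (mul_nonpos_of_nonpos_of_nonneg hδ measureReal_nonneg).trans (integral_nonneg h0)

/-- If `h k → 0` in `L¹`, then almost every point has a `k` for which all Birkhoff averages of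
`h k` are at most `δ`. This replaces the pointwise ergodic theorem in the argument. -/
lemma ae_exists_forall_birkhoffSum_le [IsProbabilityMeasure μ] (hT : MeasurePreserving T μ μ)
    {h : ℕ → X → ℝ} (hm : ∀ k, Measurable (h k)) (hi : ∀ k, Integrable (h k) μ)
    (h0 : ∀ k x, 0 ≤ h k x) (hlim : Tendsto (fun k => ∫ x, h k x ∂μ) atTop (𝓝 0))
    {δ : ℝ} (hδ : 0 < δ) :
    ∀ᵐ x ∂μ, ∃ k, ∀ n : ℕ, birkhoffSum T (h k) n x ≤ δ * n := by
  rw [ae_iff]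
  push Not
  rw [← measureReal_eq_zero_iff]
  refine le_antisymm ?_ measureReal_nonneg
  have hb : ∀ k, μ.real {x | ∀ k, ∃ n : ℕ, δ * n < birkhoffSum T (h k) n x} ≤
      (∫ x, h k x ∂μ) / δ := by
    intro k
    rw [le_div_iff₀' hδ]
    refine le_trans ?_ (mul_measureReal_lt_birkhoffSum_le hT (hm k) (hi k) (h0 k) (δ := δ))
    exact mul_le_mul_of_nonneg_left (measureReal_mono fun x hx => hx k) hδ.le
  have := hlim.div_const δ
  rw [zero_div] at this
  exact ge_of_tendsto' this hb

end Maximal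

/-! ### Tiling one orbit -/

/-- The tiling estimate along one orbit, where `Φ i n` stands for `f n (T^i x)` and `B` for the set
of bad times. A good time `i` starts a tile of length `j + σ j` whose cost `Φ i j + r i j` is at
most `c * j`; at a bad time a tile of length one and cost at most `g i` is used. Tiles are placed
until at most `K` steps remain, and these cost at most `g` each, hence at most `R` at good times.
The term `ε * |c| * n` pays for the gaps, since a tile of length `j + σ j` only yields `c * j`. -/
lemma le_sum_of_tiling {Φ : ℕ → ℕ → EReal} {r : ℕ → ℕ → ℝ} {σ : ℕ → ℕ} {g : ℕ → ℝ}
    {B : Set ℕ} {c ε R : ℝ} {K : ℕ} (hε : 0 ≤ ε) (hR0 : 0 ≤ R)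
    (hone : ∀ i, Φ i 1 ≤ (g i : EReal))
    (hstep : ∀ i m, 1 ≤ m → Φ i (m + 1) ≤ (g i : EReal) + Φ (i + 1) m)
    (hgap : ∀ i n m, 1 ≤ n → 1 ≤ m →
      Φ i (n + σ n + m) ≤ Φ i n + (r i n : EReal) + Φ (i + (n + σ n)) m)
    (hg : ∀ i, 0 ≤ g i) (hR : ∀ i, i ∉ B → g i ≤ R)
    (hgood : ∀ i, i ∉ B → ∃ j, 1 ≤ j ∧ j + σ j ≤ K ∧ (σ j : ℝ) ≤ ε * j ∧
      Φ i j + (r i j : EReal) ≤ ((c * j : ℝ) : EReal))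
    (n : ℕ) (hn : 1 ≤ n) (i : ℕ) :
    Φ i n ≤ ((n * c + ε * |c| * n +
      ∑ t ∈ Finset.range n, B.indicator (fun s => g s + |c|) (i + t) + K * (R + |c|) : ℝ) :
        EReal) := by
  have hind : ∀ t, 0 ≤ B.indicator (fun s => g s + |c|) t := fun t =>
    Set.indicator_nonneg (fun s _ => add_nonneg (hg s) (abs_nonneg c)) t
  induction n using Nat.strong_induction_on generalizing i with
  | _ n ih =>
  rcases le_or_gt n K with hnK | hnK
  -- Iterating the one-step inequality bounds `Φ i m` by a sum of values of `g`.
  · have htriv : ∀ m, 1 ≤ m → ∀ i, Φ i m ≤ ((∑ t ∈ Finset.range m, g (i + t) : ℝ) : EReal) := by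
      intro m hm
      induction m, hm using Nat.le_induction with
      | base => simpa using hone
      | succ m hm ihm =>
        intro i
        refine (hstep i m hm).trans ((add_le_add le_rfl (ihm (i + 1))).trans ?_)
        rw [← EReal.coe_add, EReal.coe_le_coe_iff, Finset.sum_range_succ']
        rw [add_comm, add_zero]
        exact (add_le_add_iff_right _).2 (Finset.sum_le_sum fun t _ => by
          rw [add_assoc, add_comm 1 t])
    refine (htriv n hn i).trans (EReal.coe_le_coe_iff.2 ?_)
    have h1 : ∑ t ∈ Finset.range n, g (i + t) ≤
        ∑ t ∈ Finset.range n, (B.indicator (fun s => g s + |c|) (i + t) + R) := by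
      refine Finset.sum_le_sum fun t _ => ?_
      by_cases ht : i + t ∈ B
      · rw [Set.indicator_of_mem ht]; linarith [abs_nonneg c]
      · rw [Set.indicator_of_notMem ht]; linarith [hR _ ht]
    rw [Finset.sum_add_distrib, Finset.sum_const, Finset.card_range, nsmul_eq_mul] at h1
    have hnK' : (n : ℝ) ≤ K := by exact_mod_cast hnK
    have h2 : (n : ℝ) * R ≤ K * R := mul_le_mul_of_nonneg_right hnK' hR0
    have h3 : (n : ℝ) * |c| ≤ K * |c| := mul_le_mul_of_nonneg_right hnK' (abs_nonneg c)
    have h4 : -((n : ℝ) * |c|) ≤ n * c := by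
      rw [← mul_neg]; exact mul_le_mul_of_nonneg_left (neg_abs_le c) (Nat.cast_nonneg n)
    have h5 : 0 ≤ ε * |c| * n := by positivity
    linarith
  · by_cases hi : i ∈ B
    · rcases Nat.exists_eq_add_of_le' hn with ⟨m, rfl⟩
      rcases Nat.eq_zero_or_pos m with rfl | hm
      · refine (hone i).trans (EReal.coe_le_coe_iff.2 ?_)
        have h0 : (0 : ℝ) ≤ K * (R + |c|) := by positivity
        have h5 : 0 ≤ ε * |c| := by positivity
        simp only [zero_add, Finset.range_one, Finset.sum_singleton, add_zero,
          Set.indicator_of_mem hi]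
        push_cast
        linarith [neg_abs_le c]
      · refine (hstep i m hm).trans ((add_le_add le_rfl (ih m (by omega) hm (i + 1))).trans ?_)
        rw [← EReal.coe_add, EReal.coe_le_coe_iff, Finset.sum_range_succ']
        have h5 : 0 ≤ ε * |c| := by positivity
        have h6 : ∀ t, i + 1 + t = i + (t + 1) := fun t => by rw [add_assoc, add_comm 1 t]
        simp only [h6, add_zero, Set.indicator_of_mem hi]
        push_cast
        linarith [neg_abs_le c]
    · obtain ⟨j, hj, hjK, hσ, hΦ⟩ := hgood i hi
      obtain ⟨m, hm, rfl⟩ : ∃ m, 1 ≤ m ∧ n = j + σ j + m := ⟨n - (j + σ j), by omega, by omega⟩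
      refine (hgap i j m hj hm).trans ((add_le_add hΦ (ih m (by omega) hm _)).trans ?_)
      rw [← EReal.coe_add, EReal.coe_le_coe_iff, Finset.sum_range_add]
      have h1 : 0 ≤ ∑ t ∈ Finset.range (j + σ j), B.indicator (fun s => g s + |c|) (i + t) :=
        Finset.sum_nonneg fun t _ => hind _
      have h2 : -(σ j : ℝ) * |c| ≤ σ j * c := by
        rw [neg_mul, ← mul_neg]
        exact mul_le_mul_of_nonneg_left (neg_abs_le c) (Nat.cast_nonneg _)
      have h3 : (σ j : ℝ) * |c| ≤ ε * j * |c| := mul_le_mul_of_nonneg_right hσ (abs_nonneg c)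
      have h4 : 0 ≤ ε * |c| * σ j := by positivity
      simp only [← add_assoc] at *
      push_cast
      linarith

/-! ### Lower and upper limits of averages in the extended reals -/

section ERealAverages

variable {u : ℕ → EReal} {a : ℝ}

lemma EReal.div_natCast_le_coe_iff {y : EReal} {n : ℕ} (hn : 1 ≤ n) :
    y / (n : EReal) ≤ (a : EReal) ↔ y ≤ ((a * n : ℝ) : EReal) := by
  rw [EReal.div_le_iff_le_mul (by exact_mod_cast hn) (EReal.natCast_ne_top n), mul_comm a,
    EReal.coe_mul, EReal.coe_natCast]

lemma frequently_le_of_liminf_div_lt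
    (h : liminf (fun n : ℕ => u n / (n : EReal)) atTop < (a : EReal)) :
    ∃ᶠ n : ℕ in atTop, u n ≤ ((a * n : ℝ) : EReal) := by
  refine ((frequently_lt_of_liminf_lt (by isBoundedDefault) h).and_eventually
    (eventually_ge_atTop 1)).mono ?_
  rintro n ⟨h1, h2⟩
  exact (EReal.div_natCast_le_coe_iff h2).1 h1.le

lemma liminf_div_le_of_frequently_le (h : ∃ᶠ n : ℕ in atTop, u n ≤ ((a * n : ℝ) : EReal)) :
    liminf (fun n : ℕ => u n / (n : EReal)) atTop ≤ (a : EReal) := by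
  refine liminf_le_of_frequently_le' ((h.and_eventually (eventually_ge_atTop 1)).mono ?_)
  rintro n ⟨h1, h2⟩
  exact (EReal.div_natCast_le_coe_iff h2).2 h1

lemma limsup_div_le_of_eventually_le (h : ∀ᶠ n : ℕ in atTop, u n ≤ ((a * n : ℝ) : EReal)) :
    limsup (fun n : ℕ => u n / (n : EReal)) atTop ≤ (a : EReal) := by
  refine limsup_le_of_le (by isBoundedDefault) ?_
  filter_upwards [h, eventually_ge_atTop 1] with n h1 h2
  exact (EReal.div_natCast_le_coe_iff h2).2 h1

/-- A one-step inequality with a finite error compares the lower limits; applied to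
`v m = f m (T x)` it shows that the lower limit does not decrease along orbits. -/
lemma liminf_div_le_liminf_div_of_shift {v : ℕ → EReal} {r : ℝ}
    (h : ∀ m, 1 ≤ m → u (m + 1) ≤ (r : EReal) + v m) :
    liminf (fun n : ℕ => u n / (n : EReal)) atTop ≤
      liminf (fun n : ℕ => v n / (n : EReal)) atTop := by
  refine le_of_forall_gt_imp_ge_of_dense fun y hy => ?_
  obtain ⟨a, ha, hay⟩ := EReal.lt_iff_exists_real_btwn.1 hy
  obtain ⟨b, hab, hby⟩ := EReal.lt_iff_exists_real_btwn.1 hay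
  refine le_trans (liminf_div_le_of_frequently_le (a := b) ?_) hby.le
  have hab' : 0 < b - a := sub_pos.2 (EReal.coe_lt_coe_iff.1 hab)
  have hev : ∀ᶠ n : ℕ in atTop, r - b ≤ (b - a) * n :=
    (tendsto_natCast_atTop_atTop.const_mul_atTop hab').eventually_ge_atTop _
  have hfr := (frequently_le_of_liminf_div_lt ha).and_eventually
    (hev.and (eventually_ge_atTop 1))
  refine (tendsto_add_atTop_nat 1).frequently (hfr.mono ?_)
  rintro n ⟨h1, h2, h3⟩
  refine (h n h3).trans ((add_le_add le_rfl h1).trans ?_)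
  rw [← EReal.coe_add, EReal.coe_le_coe_iff]
  push_cast
  linarith

end ERealAverages

/-! ### Points at which no good tile of bounded length starts -/

section BadSet

variable {X : Type*} {f : ℕ → X → EReal} {σ : ℕ → ℕ} {ρ : ℕ → X → ℝ} {g : X → ℝ}

/-- The points at which no good tile of length at most `k` starts, or at which `g` exceeds `k`.
A tile of length `j + σ j` is good at `x` if `f j x ≤ a * j` and both `ρ j x` and `σ j` are at most
`ε * j`. -/
def badSet (f : ℕ → X → EReal) (σ : ℕ → ℕ) (ρ : ℕ → X → ℝ) (g : X → ℝ) (a ε : ℝ) (k : ℕ) :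
    Set X :=
  {x | (k : ℝ) < g x ∨ ∀ j, 1 ≤ j → j + σ j ≤ k → (σ j : ℝ) ≤ ε * j →
    ¬ (f j x ≤ ((a * j : ℝ) : EReal) ∧ ρ j x ≤ ε * j)}

lemma eventually_notMem_badSet {x : X} {a ε : ℝ} (hε : 0 < ε)
    (hσ : (fun n : ℕ => (σ n : ℝ)) =o[atTop] (fun n : ℕ => (n : ℝ)))
    (hρ : Tendsto (fun n : ℕ => ρ n x / (n : ℝ)) atTop (𝓝 0))
    (hx : ∃ᶠ n : ℕ in atTop, f n x ≤ ((a * n : ℝ) : EReal)) :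
    ∀ᶠ k in atTop, x ∉ badSet f σ ρ g a ε k := by
  have h1 : ∀ᶠ n : ℕ in atTop, (σ n : ℝ) ≤ ε * n := by
    filter_upwards [hσ.bound hε] with n hn
    simpa using hn
  have h2 : ∀ᶠ n : ℕ in atTop, ρ n x ≤ ε * n := by
    filter_upwards [hρ.eventually (eventually_le_nhds hε), eventually_ge_atTop 1] with n hn hn1
    rwa [div_le_iff₀ (by exact_mod_cast hn1)] at hn
  obtain ⟨j, hj, hj1, hj2, hj3⟩ :=
    (hx.and_eventually ((h1.and h2).and (eventually_ge_atTop 1))).exists.imp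
      fun j h => (⟨h.1, h.2.1.1, h.2.1.2, h.2.2⟩ : _ ∧ _ ∧ _ ∧ _)
  filter_upwards [eventually_ge_atTop (j + σ j), eventually_ge_atTop ⌈g x⌉₊] with k hk hk'
  rintro (h | h)
  · exact absurd (Nat.ceil_le.1 hk') (not_le.2 h)
  · exact h j hj3 hk hj1 ⟨hj, hj2⟩

end BadSet

/-! ### Invariance and comparison of the lower and upper limits -/

section Dynamics

variable {X : Type*} [MeasurableSpace X] {μ : Measure X} {T : X → X}

lemma MeasureTheory.MeasurePreserving.ae_forall_iterate (hT : MeasurePreserving T μ μ)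
    {p : X → Prop} (h : ∀ᵐ x ∂μ, p x) : ∀ᵐ x ∂μ, ∀ i, p (T^[i] x) :=
  ae_all_iff.2 fun i => (hT.iterate i).quasiMeasurePreserving.ae h

/-- A function that does not decrease along orbits has almost invariant sublevel sets: the preimage
of `{L < a}` is almost contained in it and has the same finite measure. -/
lemma ae_lt_imp_forall_iterate_lt [IsFiniteMeasure μ] (hT : MeasurePreserving T μ μ)
    {L : X → EReal} (hLm : Measurable L) (hL : ∀ᵐ x ∂μ, L x ≤ L (T x)) (a : EReal) :
    ∀ᵐ x ∂μ, L x < a → ∀ i, L (T^[i] x) < a := by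
  have hS : MeasurableSet {x | L x < a} := measurableSet_lt hLm measurable_const
  have hsub : T ⁻¹' {x | L x < a} ≤ᵐ[μ] {x | L x < a} := by
    filter_upwards [hL] with x hx hx'
    exact lt_of_le_of_lt hx hx'
  have heq := ae_eq_of_ae_subset_of_measure_ge hsub
    (hT.measure_preimage hS.nullMeasurableSet).ge (hT.measurable hS).nullMeasurableSet
    (measure_ne_top _ _)
  have hinv : ∀ᵐ x ∂μ, L x < a → L (T x) < a := by
    filter_upwards [heq] with x hx hxa
    have hx' : (L (T x) < a) = (L x < a) := hx
    exact hx' ▸ hxa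
  filter_upwards [hT.ae_forall_iterate hinv] with x hx hxa i
  induction i with
  | zero => exact hxa
  | succ i ih => rw [Function.iterate_succ_apply']; exact hx i ih

variable {f : ℕ → X → EReal} {σ : ℕ → ℕ} {ρ : ℕ → X → ℝ} {g : X → ℝ}

lemma measurable_liminf_div (hf : ∀ n, 1 ≤ n → Measurable (f n)) :
    Measurable fun x => liminf (fun n : ℕ => f n x / (n : EReal)) atTop := by
  -- Shift the index, as nothing is assumed about `f 0`.
  have h : ∀ x, liminf (fun n : ℕ => f n x / (n : EReal)) atTop =
      liminf (fun n : ℕ => f (n + 1) x / ((n + 1 : ℕ) : EReal)) atTop := fun x =>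
    (liminf_nat_add (fun n : ℕ => f n x / (n : EReal)) 1).symm
  simp_rw [h]
  exact Measurable.liminf fun n => (hf (n + 1) (by omega)).mul_const _

lemma measurableSet_badSet (hf : ∀ n, 1 ≤ n → Measurable (f n)) (hρ : ∀ n, Measurable (ρ n))
    (hg : Measurable g) (a ε : ℝ) (k : ℕ) : MeasurableSet (badSet f σ ρ g a ε k) := by
  refine MeasurableSet.union (measurableSet_lt measurable_const hg)
    (measurableSet_setOfPred.2 (Measurable.forall fun j => ?_))
  by_cases hj : 1 ≤ j
  · refine measurable_const.imp (measurable_const.imp (measurable_const.imp (Measurable.not ?_)))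
    exact (measurableSet_setOfPred.1 (measurableSet_le (hf j hj) measurable_const)).and
      (measurableSet_setOfPred.1 (measurableSet_le (hρ j) measurable_const))
  · simp [hj]

/-- Almost surely, if the lower limit of `f n / n` is below `a`, then the upper limit is at most any
given `b > a`: tile the orbit by good tiles, and control the time spent in the bad set by the
maximal inequality. -/
lemma ae_limsup_div_le_of_liminf_div_lt [IsProbabilityMeasure μ] (hT : MeasurePreserving T μ μ)
    (hf : ∀ n, 1 ≤ n → Measurable (f n)) (hρm : ∀ n, Measurable (ρ n))
    (hgm : Measurable g) (hgi : Integrable g μ) (hg0 : ∀ x, 0 ≤ g x)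
    (hσ : (fun n : ℕ => (σ n : ℝ)) =o[atTop] (fun n : ℕ => (n : ℝ)))
    (hρ : ∀ᵐ x ∂μ, Tendsto (fun n : ℕ => ρ n x / (n : ℝ)) atTop (𝓝 0))
    (hone : ∀ᵐ x ∂μ, f 1 x ≤ (g x : EReal))
    (hstep : ∀ᵐ x ∂μ, ∀ m, 1 ≤ m → f (m + 1) x ≤ (g x : EReal) + f m (T x))
    (hgap : ∀ᵐ x ∂μ, ∀ n m, 1 ≤ n → 1 ≤ m →
      f (n + σ n + m) x ≤ f n x + (ρ n x : EReal) + f m (T^[n + σ n] x))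
    {a b : ℝ} (hab : a < b) :
    ∀ᵐ x ∂μ, liminf (fun n : ℕ => f n x / (n : EReal)) atTop < (a : EReal) →
      limsup (fun n : ℕ => f n x / (n : EReal)) atTop ≤ (b : EReal) := by
  set L : X → EReal := fun x => liminf (fun n : ℕ => f n x / (n : EReal)) atTop
  have hLm : Measurable L := measurable_liminf_div hf
  have hLT : ∀ᵐ x ∂μ, L x ≤ L (T x) := by
    filter_upwards [hstep] with x hx
    exact liminf_div_le_liminf_div_of_shift (v := fun m => f m (T x)) hx
  -- The tiling gives the slope `c + ε * |c| + ε` with `c = a + ε`; as `|c| ≤ |a| + 1`, it is at most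
  -- `a + ε * (|a| + 3)`.
  obtain ⟨ε, hε0, hε1, hε⟩ : ∃ ε : ℝ, 0 < ε ∧ ε ≤ 1 ∧ a + ε * (|a| + 3) < b := by
    have h3 : 0 < |a| + 4 := by positivity
    have h4 : 0 < (b - a) / (|a| + 4) := div_pos (sub_pos.2 hab) h3
    refine ⟨min 1 ((b - a) / (|a| + 4)), lt_min one_pos h4, min_le_left _ _, ?_⟩
    have h5 : min 1 ((b - a) / (|a| + 4)) * (|a| + 4) ≤ b - a := by
      rw [← le_div_iff₀ h3]; exact min_le_right _ _
    have h6 : 0 < min 1 ((b - a) / (|a| + 4)) := lt_min one_pos h4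
    linarith
  set c : ℝ := a + ε with hc
  have hcabs : |c| ≤ |a| + 1 := (abs_add_le a ε).trans (by rw [abs_of_pos hε0]; linarith)
  set S : Set X := {x | L x < (a : EReal)}
  have hSm : MeasurableSet S := measurableSet_lt hLm measurable_const
  set B : ℕ → Set X := fun k => S ∩ badSet f σ ρ g a ε k
  have hBm : ∀ k, MeasurableSet (B k) := fun k =>
    hSm.inter (measurableSet_badSet hf hρm hgm a ε k)
  -- The cost of a bad time in the tiling estimate.
  set w : X → ℝ := fun x => g x + |c|
  have hwm : Measurable w := hgm.add_const _
  have hwi : Integrable w μ := hgi.add (integrable_const _)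
  have hw0 : ∀ x, 0 ≤ w x := fun x => add_nonneg (hg0 x) (abs_nonneg c)
  have hlim : Tendsto (fun k => ∫ x, (B k).indicator w x ∂μ) atTop (𝓝 0) := by
    rw [← integral_zero X ℝ (μ := μ)]
    refine tendsto_integral_of_dominated_convergence w
      (fun k => (hwm.indicator (hBm k)).aestronglyMeasurable) hwi
      (fun k => Eventually.of_forall fun x => ?_) ?_
    · rw [Real.norm_of_nonneg (Set.indicator_nonneg (fun y _ => hw0 y) x)]
      exact Set.indicator_le_self' (fun y _ => hw0 y) x
    · filter_upwards [hρ] with x hx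
      refine tendsto_const_nhds.congr' ?_
      by_cases hxS : x ∈ S
      · filter_upwards [eventually_notMem_badSet (g := g) hε0 hσ hx
          (frequently_le_of_liminf_div_lt hxS)] with k hk
        exact (Set.indicator_of_notMem (fun h => hk h.2) w).symm
      · exact Eventually.of_forall fun k =>
          (Set.indicator_of_notMem (fun h => hxS h.1) w).symm
  filter_upwards [ae_exists_forall_birkhoffSum_le hT (fun k => hwm.indicator (hBm k))
      (fun k => hwi.indicator (hBm k)) (fun k => Set.indicator_nonneg fun y _ => hw0 y) hlim hε0,
    ae_lt_imp_forall_iterate_lt hT hLm hLT (a : EReal), hT.ae_forall_iterate hone,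
    hT.ae_forall_iterate hstep, hT.ae_forall_iterate hgap] with x hk hinv hone hstep hgap hxL
  obtain ⟨k, hk⟩ := hk
  -- The whole orbit stays in `S`, so its bad times are the visits to `badSet`.
  have hmemS : ∀ i, T^[i] x ∈ S := hinv hxL
  have hbound := le_sum_of_tiling (Φ := fun i n => f n (T^[i] x)) (r := fun i n => ρ n (T^[i] x))
    (σ := σ) (g := fun i => g (T^[i] x)) (B := {i | T^[i] x ∈ B k}) (c := c) (ε := ε) (R := k)
    (K := k) hε0.le (Nat.cast_nonneg k) hone
    (fun i m hm => by simpa only [Function.iterate_succ_apply'] using hstep i m hm)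
    (fun i n m hn hm => by
      have h := hgap i n m hn hm
      rwa [← Function.iterate_add_apply, add_comm (n + σ n) i] at h)
    (fun i => hg0 _)
    (fun i hi => not_lt.1 fun h => hi ⟨hmemS i, Or.inl h⟩)
    (fun i hi => by
      have h : T^[i] x ∉ badSet f σ ρ g a ε k := fun h => hi ⟨hmemS i, h⟩
      simp only [badSet, Set.mem_ofPred_eq, not_or, not_forall, not_not] at h
      obtain ⟨-, j, hj, hjk, hσj, hfj, hρj⟩ := h
      refine ⟨j, hj, hjk, hσj, (add_le_add hfj (EReal.coe_le_coe_iff.2 hρj)).trans ?_⟩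
      rw [← EReal.coe_add, EReal.coe_le_coe_iff, hc]
      linarith)
  apply limsup_div_le_of_eventually_le
  have hev : ∀ᶠ n : ℕ in atTop, k * (k + |c|) ≤ (b - (a + ε * (|a| + 3))) * n :=
    (tendsto_natCast_atTop_atTop.const_mul_atTop (sub_pos.2 hε)).eventually_ge_atTop _
  filter_upwards [hev, eventually_ge_atTop 1] with n hn hn1
  refine (hbound n hn1 0).trans (EReal.coe_le_coe_iff.2 ?_)
  have h1 : ∑ t ∈ Finset.range n, {i | T^[i] x ∈ B k}.indicator
      (fun s => g (T^[s] x) + |c|) (0 + t) ≤ ε * n := by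
    refine le_trans (le_of_eq ?_) (hk n)
    simp only [zero_add]
    rfl
  have h2 : ε * |c| * n ≤ ε * (|a| + 1) * n := by gcongr
  rw [hc] at *
  linarith

/-- Here `f n` is dominated by the Birkhoff sums of `g`, whose averages are almost surely bounded
by the maximal inequality applied to `g / (k + 1)`. -/
lemma ae_limsup_div_lt_top [IsProbabilityMeasure μ] (hT : MeasurePreserving T μ μ)
    (hgm : Measurable g) (hgi : Integrable g μ) (hg0 : ∀ x, 0 ≤ g x)
    (hone : ∀ᵐ x ∂μ, f 1 x ≤ (g x : EReal))
    (hstep : ∀ᵐ x ∂μ, ∀ m, 1 ≤ m → f (m + 1) x ≤ (g x : EReal) + f m (T x)) :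
    ∀ᵐ x ∂μ, limsup (fun n : ℕ => f n x / (n : EReal)) atTop < ⊤ := by
  have hlim : Tendsto (fun k : ℕ => ∫ x, g x / (k + 1 : ℝ) ∂μ) atTop (𝓝 0) := by
    simp_rw [integral_div]
    have h := (tendsto_one_div_add_atTop_nhds_zero_nat (𝕜 := ℝ)).const_mul (∫ x, g x ∂μ)
    simpa [div_eq_mul_inv] using h
  filter_upwards [ae_exists_forall_birkhoffSum_le hT (fun k => hgm.div_const ((k : ℝ) + 1))
      (fun k => hgi.div_const _) (fun k x => div_nonneg (hg0 x) (by positivity)) hlim one_pos,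
    hT.ae_forall_iterate hone, hT.ae_forall_iterate hstep] with x ⟨k, hk⟩ hone hstep
  have hle : ∀ n, 1 ≤ n → ∀ i, f n (T^[i] x) ≤ ((birkhoffSum T g n (T^[i] x) : ℝ) : EReal) := by
    intro n hn
    induction n, hn using Nat.le_induction with
    | base => simpa using hone
    | succ n hn ih =>
      intro i
      rw [birkhoffSum_succ', EReal.coe_add]
      refine (hstep i n hn).trans (add_le_add le_rfl ?_)
      simpa only [Function.iterate_succ_apply'] using ih (i + 1)
  refine lt_of_le_of_lt (limsup_div_le_of_eventually_le (a := k + 1) ?_) (EReal.coe_lt_top _)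
  filter_upwards [eventually_ge_atTop 1] with n hn
  refine (hle n hn 0).trans (EReal.coe_le_coe_iff.2 ?_)
  have h := hk n
  have hdiv : birkhoffSum T (fun y => g y / ((k : ℝ) + 1)) n x =
      birkhoffSum T g n x / ((k : ℝ) + 1) := by
    simp only [birkhoffSum, Finset.sum_div]
  rw [hdiv, div_le_iff₀ (by positivity)] at h
  simpa [mul_comm] using h

end Dynamics

/-! ### The subadditive ergodic theorem with gaps -/

theorem theorem1 {X : Type*} [MeasurableSpace X]
    (μ : Measure X) [IsProbabilityMeasure μ]
    (T : X → X) (hT : MeasurePreserving T μ μ)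
    (f : ℕ → X → EReal) (σ : ℕ → ℕ) (ρ : ℕ → X → ℝ)
    (hf_meas : ∀ n, 1 ≤ n → Measurable (f n))
    (hf_pos : ∀ n, 1 ≤ n → ∫⁻ x, (f n x).toENNReal ∂μ < ∞)
    (hσ_one : σ 1 = 0)
    (hσ : (fun n : ℕ => (σ n : ℝ)) =o[atTop] (fun n : ℕ => (n : ℝ)))
    (hρ_nonneg : ∀ n, 1 ≤ n → ∀ᵐ x ∂μ, 0 ≤ ρ n x)
    (hρ_int : ∀ n, 1 ≤ n → Integrable (ρ n) μ)
    (hρ_lim : ∀ᵐ x ∂μ, Tendsto (fun n : ℕ => ρ n x / (n : ℝ)) atTop (𝓝 0))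
    (h_gap : ∀ n m, 1 ≤ n → 1 ≤ m → ∀ᵐ x ∂μ,
      f (n + σ n + m) x ≤ f n x + (ρ n x : EReal) + f m (T^[n + σ n] x)) :
    ∃ F : X → EReal, Measurable F ∧ (∀ x, F x < ⊤) ∧
      ∀ᵐ x ∂μ, Tendsto (fun n : ℕ => f n x / (n : EReal)) atTop (𝓝 (F x)) := by
  -- The `ρ n` are only almost everywhere measurable, so measurable versions take their place.
  obtain ⟨ρ', hρ'm, hρ'⟩ : ∃ ρ' : ℕ → X → ℝ, (∀ n, Measurable (ρ' n)) ∧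
      ∀ᵐ x ∂μ, ∀ n, 1 ≤ n → ρ n x = ρ' n x := by
    have h : ∀ n, ∃ r : X → ℝ, Measurable r ∧ (1 ≤ n → ρ n =ᵐ[μ] r) := fun n => by
      by_cases hn : 1 ≤ n
      · have haem := (hρ_int n hn).aemeasurable
        exact ⟨haem.mk, haem.measurable_mk, fun _ => haem.ae_eq_mk⟩
      · exact ⟨0, measurable_zero, fun h => absurd h hn⟩
    choose r hr hr' using h
    exact ⟨r, hr, ae_all_iff.2 fun n => eventually_imp_distrib_left.2 (hr' n)⟩
  -- Since `σ 1 = 0`, the case `n = 1` of the hypothesis is a one-step inequality with error `g`.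
  set g : X → ℝ := fun x => (f 1 x).toENNReal.toReal + |ρ' 1 x| with hg
  have hf1m : Measurable fun x => (f 1 x).toENNReal := (hf_meas 1 le_rfl).ereal_toENNReal
  have hgm : Measurable g := hf1m.ennreal_toReal.add (hρ'm 1).norm
  have hρ'i : Integrable (ρ' 1) μ := (hρ_int 1 le_rfl).congr (by
    filter_upwards [hρ'] with x hx using hx 1 le_rfl)
  have hgi : Integrable g μ :=
    (integrable_toReal_of_lintegral_ne_top hf1m.aemeasurable (hf_pos 1 le_rfl).ne).add hρ'i.norm
  have hg0 : ∀ x, 0 ≤ g x := fun x => add_nonneg ENNReal.toReal_nonneg (abs_nonneg _)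
  have hf1 : ∀ᵐ x ∂μ, f 1 x ≤ (((f 1 x).toENNReal.toReal : ℝ) : EReal) := by
    filter_upwards [ae_lt_top hf1m (hf_pos 1 le_rfl).ne] with x hx
    rw [EReal.coe_ennreal_toReal hx.ne]
    exact (le_max_right 0 _).trans_eq EReal.coe_toENNReal_eq_max.symm
  have hgap : ∀ᵐ x ∂μ, ∀ n m, 1 ≤ n → 1 ≤ m →
      f (n + σ n + m) x ≤ f n x + (ρ' n x : EReal) + f m (T^[n + σ n] x) := by
    have h : ∀ᵐ x ∂μ, ∀ n m, 1 ≤ n → 1 ≤ m →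
        f (n + σ n + m) x ≤ f n x + (ρ n x : EReal) + f m (T^[n + σ n] x) := by
      simpa only [ae_all_iff, eventually_imp_distrib_left] using h_gap
    filter_upwards [h, hρ'] with x hx hx' n m hn hm
    rw [← hx' n hn]
    exact hx n m hn hm
  have hone : ∀ᵐ x ∂μ, f 1 x ≤ (g x : EReal) := by
    filter_upwards [hf1] with x hx
    exact hx.trans (EReal.coe_le_coe_iff.2 (le_add_of_nonneg_right (abs_nonneg _)))
  have hstep : ∀ᵐ x ∂μ, ∀ m, 1 ≤ m → f (m + 1) x ≤ (g x : EReal) + f m (T x) := by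
    filter_upwards [hgap, hf1] with x hx hx1 m hm
    have h := hx 1 m le_rfl hm
    rw [hσ_one, add_zero, add_comm 1 m, Function.iterate_one] at h
    refine h.trans (add_le_add ?_ le_rfl)
    rw [hg, EReal.coe_add]
    exact add_le_add hx1 (EReal.coe_le_coe_iff.2 (le_abs_self _))
  have hlim' : ∀ᵐ x ∂μ, Tendsto (fun n : ℕ => ρ' n x / (n : ℝ)) atTop (𝓝 0) := by
    filter_upwards [hρ_lim, hρ'] with x hx hx'
    refine hx.congr' ?_
    filter_upwards [eventually_ge_atTop 1] with n hn
    rw [hx' n hn]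
  set L : X → EReal := fun x => liminf (fun n : ℕ => f n x / (n : EReal)) atTop
  have hLm : Measurable L := measurable_liminf_div hf_meas
  -- The lower limit is below `⊤` only almost surely, so `⊤` is replaced by `⊥`.
  refine ⟨fun x => if L x = ⊤ then ⊥ else L x,
    Measurable.ite (hLm (measurableSet_singleton ⊤)) measurable_const hLm, fun x => ?_, ?_⟩
  · by_cases h : L x = ⊤
    · simp [h]
    · simpa [h] using lt_top_iff_ne_top.2 h
  have hcmp : ∀ᵐ x ∂μ, ∀ a b : ℚ, a < b → L x < ((a : ℝ) : EReal) →
      limsup (fun n : ℕ => f n x / (n : EReal)) atTop ≤ ((b : ℝ) : EReal) := by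
    simp only [ae_all_iff, eventually_imp_distrib_left]
    intro a b hab
    simpa only [eventually_imp_distrib_left] using
      ae_limsup_div_le_of_liminf_div_lt hT hf_meas hρ'm hgm hgi hg0 hσ hlim' hone hstep hgap
        (a := a) (b := b) (by exact_mod_cast hab)
  filter_upwards [hcmp, ae_limsup_div_lt_top hT hgm hgi hg0 hone hstep] with x hx hxtop
  have hle : L x ≤ limsup (fun n : ℕ => f n x / (n : EReal)) atTop := liminf_le_limsup
  have hge : limsup (fun n : ℕ => f n x / (n : EReal)) atTop ≤ L x := by
    by_contra! h
    obtain ⟨b, hb, hb'⟩ := EReal.lt_iff_exists_rat_btwn.1 h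
    obtain ⟨a, ha, ha'⟩ := EReal.lt_iff_exists_rat_btwn.1 hb
    exact absurd (hx a b (by exact_mod_cast EReal.coe_lt_coe_iff.1 ha') ha) (not_le.2 hb')
  rw [if_neg (lt_of_le_of_lt hle hxtop).ne]
  exact tendsto_of_le_liminf_of_limsup_le le_rfl hge
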